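/- Let $\mathcal M$ be a von Neumann algebra of bounded operators on a complex Hilbert space $H$, with unit $I$, and let $A\in\mathcal M$ be a positive operator. For $T\in\mathcal M$ put $\|T\|_A=\sup_f\sqrt{f(T^*AT)}\in[0,\infty]$, where $f$ runs over all bounded positive linear functionals on $\mathcal M$ with $f(A)=1$ (the supremum of the empty set being $0$), and let $\mathcal M^A=\{T\in\mathcal M:\|T\|_A<\infty\}$. For $T\in\mathcal M^A$ let the $A$-spectrum $\sigma_A(T)$ be the set of all $\lambda\in\mathbb C$ for which there is no $S\in\mathcal M^A$ with $A(\lambda I-T)S=AS(\lambda I-T)=A$. The socle of $\mathcal M$ is the sum of all minimal left ideals of $\mathcal M$. Then the following are equivalent: 1. $\sigma_A(T)$ is finite for every $T\in\mathcal M^A$; 2. $A$ belongs to the socle of $\mathcal M$. -/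

import Mathlib

open scoped ComplexOrder

noncomputable section

namespace ASpec

variable {H : Type*} [NormedAddCommGroup H] [InnerProductSpace ℂ H] [CompleteSpace H]
variable {M : VonNeumannAlgebra H}

/-- The set of all positive bounded linear functionals `f` on the von Neumann algebra `M` with
`f A = 1`. Positivity means `0 ≤ f X` for all `X` in `M` that are positive operators. -/
def normalizedFunctionals (A : M.toStarSubalgebra) : Set (StrongDual ℂ M.toStarSubalgebra) :=
  {f | (∀ X : M.toStarSubalgebra, (X : H →L[ℂ] H).IsPositive → 0 ≤ f X) ∧ f A = 1}

/-- The `A`-seminorm `‖T‖_A = sup { √ f(T* A T) }`, the supremum being over all positive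
functionals `f` on `M` with `f A = 1`; it may be infinite. -/
def aSeminorm (A T : M.toStarSubalgebra) : ENNReal :=
  ⨆ f ∈ normalizedFunctionals A, ENNReal.ofReal (Real.sqrt (f (star T * A * T)).re)

/-- The set `M^A` of all `T` in `M` with `‖T‖_A < ∞`. -/
def aBounded (A : M.toStarSubalgebra) : Set M.toStarSubalgebra :=
  {T | aSeminorm A T < ⊤}

/-- `T` (an element of `M^A`) is `A`-invertible in `M^A`: there is `S` in `M^A` with
`A T S = A S T = A`. -/
def IsAInvertible (A T : M.toStarSubalgebra) : Prop :=
  ∃ S ∈ aBounded A, A * T * S = A ∧ A * S * T = A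

/-- The `A`-spectrum of `T` (an element of `M^A`): all `z` such that `z I - T` is not
`A`-invertible in `M^A`. -/
def aSpectrum (A T : M.toStarSubalgebra) : Set ℂ :=
  {z | ¬ IsAInvertible A (algebraMap ℂ M.toStarSubalgebra z - T)}

/-- The socle of a ring: the sum of all minimal (nonzero) left ideals. -/
def socle (R : Type*) [Ring R] : Submodule R R :=
  sSup {I : Submodule R R | IsAtom I}

end ASpec

end

/-!
Everything is reduced to the corner `P M P` of the support projection `P` of `A`.

If `A` has finite spectrum, then the functional calculus provides `P` and an inverse `B` of `A` in
`P M P` (`exists_isSupportInverse`). Then `A` and `P` dominate multiples of each other, so every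
`S = S P` lies in `M^A` (`IsSupportInverse.mem_aBounded`). Conversely, elements of `M^A` preserve
the kernel of `A` (`apply_apply_eq_zero_of_mem_aBounded`), so they act on the range of `P`. Hence
the `A`-spectrum is governed by invertibility in `P M P`. In both directions of the equivalence it
is part of the work to show that the spectrum of `A` is finite.

If `A` is in the socle, the left ideal `M A` has finite length. Right multiplication by an element
`X` preserving such an ideal has only finitely many eigenvalues (`finite_setOf_mul_eq_smul`), and
for every other `z`, right multiplication by `z - X` is bijective. For `X = A` this shows that the
spectrum of `A` is finite (`finite_spectrum_of_mem_socle`), and for `X = P T` with `T` in `M^A` that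
the `A`-spectrum of `T` is finite (`finite_aSpectrum_of_mem_socle`).

If all `A`-spectra are finite, then `A` has finite spectrum, and so does every self-adjoint element
of `P M P` (`IsSupportInverse.spectrum_subset`). A strictly decreasing sequence `e₀ > e₁ > ⋯` of
projections below `P` would yield `∑ 2⁻ⁿ eₙ`, with infinite spectrum
(`exists_infinite_spectrum_of_descending`). So the projections below `P` satisfy the descending
chain condition, and `P` is a finite sum of minimal projections `e`. A positive element
`(x e)* (x e)` of `e M e` has finite spectrum, so by minimality of `e` it is a multiple of `e`,
whence `M e` is a minimal left ideal. Therefore `P`, and with it `A = A P`, lies in the socle.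
-/

namespace ASpec

/-! ### Finite spectrum and the functional calculus in `M` -/

section Operator

variable {H : Type*} [NormedAddCommGroup H] [InnerProductSpace ℂ H] [CompleteSpace H]
variable {M : VonNeumannAlgebra H}

/-- One half of the double commutant identity `M'' = M`. -/
theorem mem_of_commute_commutant {x : H →L[ℂ] H}
    (h : ∀ y ∈ M.commutant, Commute x y) : x ∈ M := by
  rw [← M.commutant_commutant, VonNeumannAlgebra.mem_commutant_iff]
  exact fun y hy => (h y hy).eq.symm

theorem commute_of_mem_commutant {x y : H →L[ℂ] H} (hx : x ∈ M) (hy : y ∈ M.commutant) :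
    Commute x y :=
  VonNeumannAlgebra.mem_commutant_iff.1 hy x hx

theorem cfc_mem {T : H →L[ℂ] H} (hT : T ∈ M) (f : ℝ → ℝ) : cfc f T ∈ M :=
  mem_of_commute_commutant fun _ hy => (commute_of_mem_commutant hT hy).cfc_real f

omit [CompleteSpace H] in
theorem finite_real_spectrum {T : H →L[ℂ] H} (hfin : (spectrum ℂ T).Finite) :
    (spectrum ℝ T).Finite := by
  rw [← spectrum.preimage_algebraMap ℂ]
  exact hfin.preimage (algebraMap ℝ ℂ).injective.injOn

/-- Since every function is continuous on a finite spectrum, the functional calculus may be applied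
to `x ↦ x⁻¹` (with `0⁻¹ = 0`) and to `x ↦ x x⁻¹`, the indicator function of the nonzero numbers. -/
theorem exists_support {T : H →L[ℂ] H} (hT : T ∈ M) (hsa : IsSelfAdjoint T)
    (hfin : (spectrum ℂ T).Finite) :
    ∃ B ∈ M, ∃ P ∈ M, IsSelfAdjoint B ∧ IsStarProjection P ∧
      T * B = P ∧ B * T = P ∧ T * P = T := by
  have hc (f : ℝ → ℝ) : ContinuousOn f (spectrum ℝ T) := (finite_real_spectrum hfin).continuousOn f
  have hid : cfc (fun x : ℝ => x) T = T := cfc_id' ℝ T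
  have hTB : T * cfc (fun x : ℝ => x⁻¹) T = cfc (fun x : ℝ => x * x⁻¹) T := by
    conv_lhs => enter [1]; rw [← hid]
    rw [← cfc_mul _ _ T (hc _) (hc _)]
  have hBT : cfc (fun x : ℝ => x⁻¹) T * T = cfc (fun x : ℝ => x * x⁻¹) T := by
    conv_lhs => enter [2]; rw [← hid]
    rw [← cfc_mul _ _ T (hc _) (hc _)]
    simp only [mul_comm]
  have hPT : cfc (fun x : ℝ => x * x⁻¹) T * T = T := by
    conv_lhs => enter [2]; rw [← hid]
    rw [← cfc_mul _ _ T (hc _) (hc _)]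
    simp only [mul_inv_mul_cancel]
    exact hid
  refine ⟨cfc (fun x : ℝ => x⁻¹) T, cfc_mem hT _, cfc (fun x : ℝ => x * x⁻¹) T, cfc_mem hT _,
    IsSelfAdjoint.cfc, ⟨?_, IsSelfAdjoint.cfc⟩, hTB, hBT, ?_⟩
  · rw [IsIdempotentElem, ← cfc_mul _ _ T (hc _) (hc _)]
    refine cfc_congr fun x _ => ?_
    by_cases hx : x = 0 <;> simp [hx]
  · rw [← hBT, ← mul_assoc, hTB, hPT]

/-- A nonzero self-adjoint element with finite spectrum has a nonzero spectral projection `Q` for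
some nonzero eigenvalue `r`; as `Q` is a multiple of `T`, it lies in every corner containing `T`. -/
theorem exists_eigenprojection {T : H →L[ℂ] H} (hT : T ∈ M) (hsa : IsSelfAdjoint T)
    (hfin : (spectrum ℂ T).Finite) (h0 : T ≠ 0) :
    ∃ r : ℝ, r ≠ 0 ∧ ∃ Q ∈ M, ∃ G ∈ M, IsStarProjection Q ∧ Q ≠ 0 ∧
      T * G = Q ∧ T * Q = r • Q := by
  have hc (f : ℝ → ℝ) : ContinuousOn f (spectrum ℝ T) := (finite_real_spectrum hfin).continuousOn f
  have hid : cfc (fun x : ℝ => x) T = T := cfc_id' ℝ T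
  obtain ⟨r, hr, hr0⟩ : ∃ r ∈ spectrum ℝ T, r ≠ 0 := by
    by_contra! h
    exact h0 (CFC.eq_zero_of_spectrum_subset_zero (R := ℝ) T fun x hx => h x hx)
  have hmul (f g h : ℝ → ℝ) (hfg : ∀ x, f x * g x = h x) : cfc f T * cfc g T = cfc h T := by
    rw [← cfc_mul _ _ T (hc _) (hc _)]
    simp only [hfg]
  have hT1 (f h : ℝ → ℝ) (hfg : ∀ x, x * f x = h x) : T * cfc f T = cfc h T := by
    conv_lhs => enter [1]; rw [← hid]
    exact hmul _ _ _ hfg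
  refine ⟨r, hr0, cfc (fun x => if x = r then 1 else 0) T, cfc_mem hT _,
    cfc (fun x => if x = r then r⁻¹ else 0) T, cfc_mem hT _,
    ⟨?_, IsSelfAdjoint.cfc⟩, ?_, ?_, ?_⟩
  · exact hmul _ _ _ fun x => by split_ifs <;> simp
  · intro h
    rw [← cfc_zero ℝ T] at h
    simpa using eqOn_of_cfc_eq_cfc h (hc _) (hc _) hsa hr
  · exact hT1 _ _ fun x => by split_ifs with h <;> simp [h, hr0]
  · rw [← cfc_smul _ _ T (hc _)]
    exact hT1 _ _ fun x => by split_ifs with h <;> simp [h]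

/-! ### Boundedness for the `A`-seminorm -/

/-- The operator `X A` equals `√A X √A`, which is at most `√A ‖X‖ √A`. -/
theorem mul_le_norm_smul_of_commute {A X : H →L[ℂ] H} (hA : 0 ≤ A) (hX : IsSelfAdjoint X)
    (h : Commute A X) : X * A ≤ ‖X‖ • A := by
  have hs : star (CFC.sqrt A) = CFC.sqrt A := (CFC.sqrt_nonneg A).isSelfAdjoint
  have hss : CFC.sqrt A * CFC.sqrt A = A := CFC.sqrt_mul_sqrt_self A
  have hcomm : Commute (CFC.sqrt A) X := by
    rw [CFC.sqrt_eq_cfc]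
    exact h.cfc_nnreal _
  have := CStarAlgebra.star_left_conjugate_le_norm_smul (a := CFC.sqrt A) (b := X)
  rwa [hs, hss, hcomm.eq, mul_assoc, hss] at this

theorem mem_aBounded_of_le {A S : M.toStarSubalgebra} {c : ℝ}
    (h : star (S : H →L[ℂ] H) * A * S ≤ c • (A : H →L[ℂ] H)) : S ∈ aBounded A := by
  refine lt_of_le_of_lt (iSup₂_le fun f hf => ?_) (ENNReal.ofReal_lt_top (r := Real.sqrt c))
  refine ENNReal.ofReal_le_ofReal (Real.sqrt_le_sqrt ?_)
  have hpos := hf.1 ((c : ℂ) • A - star S * A * S) (by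
    rw [ContinuousLinearMap.le_def] at h
    exact h)
  rw [map_sub, map_smul, hf.2] at hpos
  have := (Complex.le_def.1 hpos).1
  simpa using this

/-- The functional `X ↦ ⟪v, X v⟫` on `M`. -/
noncomputable def vectorFunctional (M : VonNeumannAlgebra H) (v : H) :
    StrongDual ℂ M.toStarSubalgebra :=
  (innerSL ℂ v).comp ((ContinuousLinearMap.apply ℂ H v).comp
    (Subalgebra.toSubmodule M.toStarSubalgebra.toSubalgebra).subtypeL)

theorem vectorFunctional_apply (v : H) (X : M.toStarSubalgebra) :
    vectorFunctional M v X = inner ℂ v ((X : H →L[ℂ] H) v) := rfl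

theorem vectorFunctional_nonneg (v : H) (X : M.toStarSubalgebra)
    (hX : (X : H →L[ℂ] H).IsPositive) : 0 ≤ vectorFunctional M v X :=
  hX.inner_nonneg_right v

theorem apply_eq_zero_of_inner_eq_zero {A : H →L[ℂ] H} (hA : A.IsPositive) {v : H}
    (h : inner ℂ v (A v) = 0) : A v = 0 := by
  have hA' : 0 ≤ A := A.nonneg_iff_isPositive.2 hA
  have hss : CFC.sqrt A * CFC.sqrt A = A := CFC.sqrt_mul_sqrt_self A
  have hs := (CFC.sqrt_nonneg A).isSelfAdjoint
  have key : CFC.sqrt A v = 0 := by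
    rw [← hss, mul_apply_eq_comp, ← ContinuousLinearMap.adjoint_inner_left,
      ← ContinuousLinearMap.star_eq_adjoint, hs.star_eq, inner_self_eq_zero] at h
    exact h
  rw [← hss, mul_apply_eq_comp, key, map_zero]

/-- Elements of `M^A` preserve the kernel of `A`. For `v` in the kernel, adding multiples of the
vector functional of `v` to a normalized functional keeps it normalized, so for `A ≠ 0`
a nonzero value of `⟪v, T* A T v⟫` would make `‖T‖_A` infinite. -/
theorem apply_apply_eq_zero_of_mem_aBounded {A T : M.toStarSubalgebra}
    (hA : (A : H →L[ℂ] H).IsPositive) (hT : T ∈ aBounded A) {v : H}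
    (hv : (A : H →L[ℂ] H) v = 0) : (A : H →L[ℂ] H) ((T : H →L[ℂ] H) v) = 0 := by
  by_cases hA0 : (A : H →L[ℂ] H) = 0
  -- for `A = 0` there are no normalized functionals, but then the claim is trivial
  · simp [hA0]
  obtain ⟨w, hw⟩ : ∃ w, inner ℂ w ((A : H →L[ℂ] H) w) ≠ 0 := by
    by_contra! h
    exact hA0 (by ext w; exact apply_eq_zero_of_inner_eq_zero hA (h w))
  obtain ⟨a, ha⟩ : ∃ a : ℝ, inner ℂ w ((A : H →L[ℂ] H) w) = a := by
    refine ⟨_, Complex.eq_re_of_ofReal_le (r := 0) ?_⟩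
    simpa using hA.inner_nonneg_right w
  have ha0 : 0 < a := by
    have h1 := hA.inner_nonneg_right w
    rw [ha] at h1 hw
    exact lt_of_le_of_ne (by exact_mod_cast h1) (fun h => hw (by simp [← h]))
  have hTT : inner ℂ v (((star T * A * T : M.toStarSubalgebra) : H →L[ℂ] H) v)
      = inner ℂ ((T : H →L[ℂ] H) v) ((A : H →L[ℂ] H) ((T : H →L[ℂ] H) v)) := by
    rw [← ContinuousLinearMap.adjoint_inner_right]
    rfl
  have hpos (u : H) : 0 ≤ (inner ℂ u (((star T * A * T : M.toStarSubalgebra) : H →L[ℂ] H) u)).re :=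
    (Complex.le_def.1 (vectorFunctional_nonneg (M := M) u (star T * A * T)
      (hA.adjoint_conj (T : H →L[ℂ] H)))).1
  -- the functionals `a⁻¹ ω_w + n ω_v` are all normalized, as `ω_v A = 0`
  have hmem (n : ℕ) :
      ((a⁻¹ : ℝ) : ℂ) • vectorFunctional M w + ((n : ℝ) : ℂ) • vectorFunctional M v
      ∈ normalizedFunctionals A := by
    constructor
    · intro X hX
      exact add_nonneg
        (mul_nonneg (by exact_mod_cast (inv_pos.2 ha0).le) (vectorFunctional_nonneg w X hX))
        (mul_nonneg (by exact_mod_cast n.zero_le) (vectorFunctional_nonneg v X hX))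
    · simp [vectorFunctional_apply, hv, ha, ha0.ne']
  have hbd (n : ℕ) : (n : ℝ) * (inner ℂ v (((star T * A * T : M.toStarSubalgebra) :
      H →L[ℂ] H) v)).re ≤ (aSeminorm A T).toReal ^ 2 := by
    have h1 : ENNReal.ofReal _ ≤ aSeminorm A T := le_iSup₂_of_le _ (hmem n) le_rfl
    rw [ENNReal.ofReal_le_iff_le_toReal (ne_of_lt hT),
      Real.sqrt_le_left ENNReal.toReal_nonneg] at h1
    refine le_trans ?_ h1
    have h2 := mul_nonneg (inv_pos.2 ha0).le (hpos w)
    simp only [add_apply, smul_apply, vectorFunctional_apply,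
      smul_eq_mul, Complex.add_re, Complex.re_ofReal_mul]
    linarith
  have hre : (inner ℂ v (((star T * A * T : M.toStarSubalgebra) : H →L[ℂ] H) v)).re = 0 := by
    by_contra hne
    obtain ⟨n, hn⟩ := Archimedean.arch ((aSeminorm A T).toReal ^ 2 + 1)
      (lt_of_le_of_ne (hpos v) (Ne.symm hne))
    rw [nsmul_eq_mul] at hn
    linarith [hbd n]
  apply apply_eq_zero_of_inner_eq_zero hA
  have h3 := hA.inner_nonneg_right ((T : H →L[ℂ] H) v)
  rw [hTT] at hre
  exact Complex.ext hre (Complex.le_def.1 h3).2.symm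

end Operator

/-! ### Left ideals of finite length and the socle -/

section Algebra

variable {K R : Type*} [Field K] [Ring R] [Algebra K R]

theorem mul_algebraMap_sub_of_mul_eq_smul {l X : R} {z : K} (h : l * X = z • l) (w : K) :
    l * (algebraMap K R w - X) = (w - z) • l := by
  rw [mul_sub, h, sub_smul, ← Algebra.commutes, ← Algebra.smul_def]

/-- Right multiplication by `X` has only finitely many eigenvalues on a Noetherian left ideal `L`:
for distinct eigenvalues `z₀, z₁, …` the annihilators in `L` of the products
`(z₀ - X) ⋯ (zₙ₋₁ - X)` would form a strictly increasing chain of left ideals. -/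
theorem finite_setOf_mul_eq_smul (L : Submodule R R) [IsNoetherian R L] (X : R) :
    {z : K | ∃ l ∈ L, l ≠ 0 ∧ l * X = z • l}.Finite := by
  by_contra hinf
  let z : ℕ → K := fun n => (Set.Infinite.natEmbedding _ hinf n : K)
  have hz : Function.Injective z :=
    Subtype.val_injective.comp (Set.Infinite.natEmbedding _ hinf).injective
  choose v hvL hv0 hvX using fun n => (Set.Infinite.natEmbedding _ hinf n).2
  let y : ℕ → R := fun n => Nat.rec 1 (fun k r => r * (algebraMap K R (z k) - X)) n
  have hy (n : ℕ) : y (n + 1) = y n * (algebraMap K R (z n) - X) := rfl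
  have hvy (n k : ℕ) : v n * y k = (∏ i ∈ Finset.range k, (z i - z n)) • v n := by
    induction k with
    | zero => simp [y]
    | succ k ih =>
      rw [hy, ← mul_assoc, ih, smul_mul_assoc, mul_algebraMap_sub_of_mul_eq_smul (hvX n),
        smul_smul, Finset.prod_range_succ]
  let W : ℕ →o Submodule R L :=
    { toFun := fun n => LinearMap.ker ((LinearMap.toSpanSingleton R R (y n)).comp L.subtype)
      monotone' := monotone_nat_of_le_succ fun n l hl => by
        simp only [LinearMap.mem_ker, LinearMap.comp_apply, LinearMap.toSpanSingleton_apply,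
          smul_eq_mul, Submodule.subtype_apply] at hl ⊢
        rw [hy, ← mul_assoc, hl, zero_mul] }
  have hvW (n k : ℕ) : (⟨v n, hvL n⟩ : L) ∈ W k ↔
      (∏ i ∈ Finset.range k, (z i - z n)) • v n = 0 := by
    rw [← hvy]; rfl
  obtain ⟨n, hn⟩ := monotone_stabilizes_iff_noetherian.2 (inferInstanceAs (IsNoetherian R L)) W
  have h1 : (⟨v n, hvL n⟩ : L) ∈ W (n + 1) := by
    rw [hvW, Finset.prod_eq_zero (Finset.self_mem_range_succ n) (sub_self _), zero_smul]
  rw [← hn (n + 1) n.le_succ, hvW, smul_eq_zero] at h1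
  refine h1.elim (fun h => ?_) (hv0 n)
  obtain ⟨i, hi, h⟩ := Finset.prod_eq_zero_iff.1 h
  exact (Finset.mem_range.1 hi).ne (hz (sub_eq_zero.1 h))

/-- On an Artinian left ideal, right multiplication by `z - X` is surjective if it is injective. -/
theorem exists_mul_sub_eq_of_not_eigenvalue {L : Submodule R R} [IsArtinian R L] {X : R}
    (hX : ∀ l ∈ L, l * X ∈ L) {z : K} (hz : ∀ l ∈ L, l * X = z • l → l = 0) {l : R} (hl : l ∈ L) :
    ∃ s ∈ L, s * (algebraMap K R z - X) = l := by
  have hmem (s : R) (hs : s ∈ L) : s * (algebraMap K R z - X) ∈ L := by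
    rw [mul_sub, ← Algebra.commutes]
    exact L.sub_mem (L.smul_mem (algebraMap K R z) hs) (hX s hs)
  let f : L →ₗ[R] L :=
    ((LinearMap.toSpanSingleton R R (algebraMap K R z - X)).comp L.subtype).codRestrict L
      fun s => hmem s s.2
  have hf (s : L) : (f s : R) = s * (algebraMap K R z - X) := rfl
  have hinj : Function.Injective f := by
    rw [← LinearMap.ker_eq_bot, LinearMap.ker_eq_bot']
    intro s hs
    have h0 : (s : R) * (algebraMap K R z - X) = 0 := by rw [← hf, hs]; rfl
    rw [mul_sub, sub_eq_zero, ← Algebra.commutes, ← Algebra.smul_def] at h0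
    exact Subtype.ext (hz s s.2 h0.symm)
  obtain ⟨s, hs⟩ := IsArtinian.surjective_of_injective_endomorphism f hinj ⟨l, hl⟩
  exact ⟨s, s.2, by rw [← hf, hs]⟩

end Algebra

section Socle

variable {R : Type*} [Ring R]

theorem exists_le_finiteLength_of_mem_socle {a : R} (ha : a ∈ socle R) :
    ∃ N : Submodule R R, a ∈ N ∧ IsNoetherian R N ∧ IsArtinian R N := by
  obtain ⟨s, hs, has⟩ := Submodule.mem_sSup_iff_exists_finset.1 ha
  refine ⟨_, has, ?_⟩
  have hsimple (i : s) : IsSimpleModule R (i : Submodule R R) :=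
    isSimpleModule_iff_isAtom.2 (hs i.2)
  rw [iSup_subtype']
  exact ⟨inferInstance, inferInstance⟩

theorem isNoetherian_span_of_mem_socle {a : R} (ha : a ∈ socle R) :
    IsNoetherian R (Submodule.span R {a}) := by
  obtain ⟨N, haN, hN, -⟩ := exists_le_finiteLength_of_mem_socle ha
  exact isNoetherian_of_le ((Submodule.span_singleton_le_iff_mem a N).2 haN)

theorem isArtinian_span_of_mem_socle {a : R} (ha : a ∈ socle R) :
    IsArtinian R (Submodule.span R {a}) := by
  obtain ⟨N, haN, -, hN⟩ := exists_le_finiteLength_of_mem_socle ha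
  exact isArtinian_of_le ((Submodule.span_singleton_le_iff_mem a N).2 haN)

/-- Under the hypothesis, the left ideal `R e` is minimal unless `e = 0`. -/
theorem mem_socle_of_forall_exists_mul_eq {e : R}
    (h : ∀ x, x * e ≠ 0 → ∃ y, y * (x * e) = e) : e ∈ socle R := by
  by_cases he : e = 0
  · rw [he]; exact zero_mem _
  have hatom : IsAtom (Submodule.span R {e}) := by
    refine ⟨by simpa using he, fun I hI => ?_⟩
    by_contra hne
    obtain ⟨i, hi, hi0⟩ := Submodule.exists_mem_ne_zero_of_ne_bot hne
    obtain ⟨x, rfl⟩ := Submodule.mem_span_singleton.1 (hI.le hi)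
    obtain ⟨y, hy⟩ := h x hi0
    refine hI.not_ge ((Submodule.span_singleton_le_iff_mem e I).2 ?_)
    rw [← hy]
    exact I.smul_mem y hi
  exact (le_sSup hatom : _ ≤ socle R) (Submodule.mem_span_singleton_self e)

end Socle

section VonNeumann

variable {H : Type*} [NormedAddCommGroup H] [InnerProductSpace ℂ H] [CompleteSpace H]
variable {M : VonNeumannAlgebra H}

/-! ### The support projection and the inverse in its corner -/

/-- `P` is the support projection of the self-adjoint element `A` and `B` is the inverse of `A`
in the corner `P M P`. -/
structure IsSupportInverse (A B P : M.toStarSubalgebra) : Prop where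
  isSelfAdjoint_inv : IsSelfAdjoint (B : H →L[ℂ] H)
  star_proj : star P = P
  proj_mul_proj : P * P = P
  mul_inv : A * B = P
  inv_mul : B * A = P
  mul_proj : A * P = A

theorem exists_isSupportInverse {A : M.toStarSubalgebra} (hsa : IsSelfAdjoint (A : H →L[ℂ] H))
    (hfin : (spectrum ℂ (A : H →L[ℂ] H)).Finite) : ∃ B P, IsSupportInverse A B P := by
  obtain ⟨B, hB, P, hP, hBsa, hPproj, h1, h2, h3⟩ := exists_support A.2 hsa hfin
  exact ⟨⟨B, hB⟩, ⟨P, hP⟩, hBsa, Subtype.ext hPproj.isSelfAdjoint,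
    Subtype.ext hPproj.isIdempotentElem, Subtype.ext h1, Subtype.ext h2,
    Subtype.ext h3⟩

/-- Here `A* A A = A² A ≤ ‖A²‖ A`. -/
theorem self_mem_aBounded {A : M.toStarSubalgebra} (hA : (A : H →L[ℂ] H).IsPositive) :
    A ∈ aBounded A := by
  have hA' : 0 ≤ (A : H →L[ℂ] H) := (ContinuousLinearMap.nonneg_iff_isPositive _).2 hA
  have hsa : IsSelfAdjoint (A : H →L[ℂ] H) := hA'.isSelfAdjoint
  refine mem_aBounded_of_le (c := ‖(A : H →L[ℂ] H) * A‖) ?_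
  rw [hsa.star_eq]
  refine mul_le_norm_smul_of_commute hA' ?_ ((Commute.refl _).mul_right (Commute.refl _))
  rw [IsSelfAdjoint, star_mul, hsa.star_eq]

/-- If `S = S P`, then `S* A S = P (S* A S) P ≤ ‖S* A S‖ P`, and `P = B A ≤ ‖B‖ A`. -/
theorem IsSupportInverse.mem_aBounded {A B P S : M.toStarSubalgebra}
    (h : IsSupportInverse A B P) (hA : (A : H →L[ℂ] H).IsPositive) (hS : S * P = S) :
    S ∈ aBounded A := by
  have hA' : 0 ≤ (A : H →L[ℂ] H) := (ContinuousLinearMap.nonneg_iff_isPositive _).2 hA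
  have hPA : (P : H →L[ℂ] H) ≤ ‖(B : H →L[ℂ] H)‖ • (A : H →L[ℂ] H) := by
    have hcomm : Commute (A : H →L[ℂ] H) B :=
      congrArg Subtype.val (h.mul_inv.trans h.inv_mul.symm)
    have := mul_le_norm_smul_of_commute hA' h.isSelfAdjoint_inv hcomm
    rwa [show (B : H →L[ℂ] H) * A = P from congrArg Subtype.val h.inv_mul] at this
  have hSP : (S : H →L[ℂ] H) * P = S := congrArg Subtype.val hS
  have hPP : star (P : H →L[ℂ] H) * P = P :=
    congrArg Subtype.val ((congrArg (· * P) h.star_proj).trans h.proj_mul_proj)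
  set C : H →L[ℂ] H := star (S : H →L[ℂ] H) * A * S with hC
  have hCsa : IsSelfAdjoint C := (star_left_conjugate_nonneg hA' (S : H →L[ℂ] H)).isSelfAdjoint
  refine mem_aBounded_of_le (c := ‖C‖ * ‖(B : H →L[ℂ] H)‖) ?_
  calc C = star (P : H →L[ℂ] H) * C * P := by
        conv_lhs => rw [hC, ← hSP]
        simp only [hC, star_mul, mul_assoc]
    _ ≤ ‖C‖ • (star (P : H →L[ℂ] H) * P) := CStarAlgebra.star_left_conjugate_le_norm_smul
    _ = ‖C‖ • (P : H →L[ℂ] H) := by rw [hPP]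
    _ ≤ ‖C‖ • (‖(B : H →L[ℂ] H)‖ • (A : H →L[ℂ] H)) :=
        smul_le_smul_of_nonneg_left hPA (norm_nonneg _)
    _ = _ := smul_smul _ _ _

/-- For `T ∈ M^A`, `A T` vanishes on the kernel of `A`, that is, on the range of `1 - P`. -/
theorem IsSupportInverse.mul_mul_proj {A B P T : M.toStarSubalgebra}
    (h : IsSupportInverse A B P) (hA : (A : H →L[ℂ] H).IsPositive) (hT : T ∈ aBounded A) :
    A * T * P = A * T := by
  have key : A * T * (1 - P) = 0 := by
    refine Subtype.ext (ContinuousLinearMap.ext fun v => ?_)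
    have hv : (A : H →L[ℂ] H) (((1 - P : M.toStarSubalgebra) : H →L[ℂ] H) v) = 0 := by
      have : A * (1 - P) = 0 := by rw [mul_sub, mul_one, h.mul_proj, sub_self]
      exact congrArg (fun X : M.toStarSubalgebra => (X : H →L[ℂ] H) v) this
    exact apply_apply_eq_zero_of_mem_aBounded hA hT hv
  rw [mul_sub, mul_one, sub_eq_zero] at key
  exact key.symm

/-! ### Elements of the socle have finite `A`-spectra -/

/-- If `z ≠ 0` is not an eigenvalue of right multiplication by `A` on the finite length left ideal
`M A`, then `S (z - A) = A` for some `S`, so `z⁻¹ (S + 1)` is a left inverse of `z - A`. -/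
theorem finite_spectrum_of_mem_socle {A : M.toStarSubalgebra}
    (hsa : IsSelfAdjoint (A : H →L[ℂ] H)) (hA : A ∈ socle M.toStarSubalgebra) :
    (spectrum ℂ (A : H →L[ℂ] H)).Finite := by
  set L := Submodule.span M.toStarSubalgebra {A}
  have : IsNoetherian M.toStarSubalgebra L := isNoetherian_span_of_mem_socle hA
  have : IsArtinian M.toStarSubalgebra L := isArtinian_span_of_mem_socle hA
  have hAL : A ∈ L := Submodule.mem_span_singleton_self A
  refine ((finite_setOf_mul_eq_smul (K := ℂ) L A).insert 0).subset fun z hz => ?_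
  by_contra hbad
  rw [Set.mem_insert_iff, not_or] at hbad
  obtain ⟨hz0, hbad⟩ := hbad
  obtain ⟨S, -, hS⟩ := exists_mul_sub_eq_of_not_eigenvalue (L := L) (X := A) (z := z)
    (fun l _ => L.smul_mem l hAL)
    (fun l hl h => by_contra fun hne => hbad ⟨l, hl, hne, h⟩) hAL
  replace hS : (S : H →L[ℂ] H) * (algebraMap ℂ _ z - A) = A := congrArg Subtype.val hS
  -- spectral values `z` are real, so a left inverse of `z - A` gives a right one by adjunction
  have hN : star (algebraMap ℂ (H →L[ℂ] H) z - A) = algebraMap ℂ _ z - A := by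
    rw [star_sub, hsa.star_eq, ← algebraMap_star_comm]
    congr 2
    rw [hsa.mem_spectrum_eq_re hz]
    exact Complex.conj_ofReal _
  have hleft : (z⁻¹ • ((S : H →L[ℂ] H) + 1)) * (algebraMap ℂ _ z - A) = 1 := by
    rw [smul_mul_assoc, add_mul, hS, one_mul, add_sub_cancel, Algebra.algebraMap_eq_smul_one,
      smul_smul, inv_mul_cancel₀ hz0, one_smul]
  have hright : (algebraMap ℂ _ z - A) * star (z⁻¹ • ((S : H →L[ℂ] H) + 1)) = 1 := by
    have := congrArg star hleft
    rwa [star_mul, hN, star_one] at this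
  rw [spectrum.mem_iff] at hz
  exact hz (isUnit_iff_exists_and_exists.2 ⟨⟨_, hright⟩, ⟨_, hleft⟩⟩)

/-- If `A` lies in the socle, the elements of `M^A` act by right multiplication, modulo the
kernel of `A`, on the finite length left ideal `M A`, and points of the `A`-spectrum are
eigenvalues of this action. -/
theorem finite_aSpectrum_of_mem_socle {A : M.toStarSubalgebra}
    (hA : (A : H →L[ℂ] H).IsPositive) (hsoc : A ∈ socle M.toStarSubalgebra)
    {T : M.toStarSubalgebra} (hT : T ∈ aBounded A) : (aSpectrum A T).Finite := by
  have hsa : IsSelfAdjoint (A : H →L[ℂ] H) := hA.isSelfAdjoint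
  obtain ⟨B, P, h⟩ := exists_isSupportInverse hsa (finite_spectrum_of_mem_socle hsa hsoc)
  set L := Submodule.span M.toStarSubalgebra {A}
  have : IsNoetherian M.toStarSubalgebra L := isNoetherian_span_of_mem_socle hsoc
  have : IsArtinian M.toStarSubalgebra L := isArtinian_span_of_mem_socle hsoc
  have hAL : A ∈ L := Submodule.mem_span_singleton_self A
  have hPL : P ∈ L := h.inv_mul ▸ L.smul_mem B hAL
  have hLP {l} (hl : l ∈ L) : l * P = l := by
    obtain ⟨m, rfl⟩ := Submodule.mem_span_singleton.1 hl
    rw [smul_eq_mul, mul_assoc, h.mul_proj]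
  have hPTP : P * T * P = P * T := by
    have := congrArg (B * ·) (h.mul_mul_proj hA hT)
    simpa only [← mul_assoc, h.inv_mul] using this
  have hXL (l) (hl : l ∈ L) : l * (P * T) ∈ L := by
    rw [← hPTP, ← mul_assoc]
    exact L.smul_mem _ hPL
  refine (finite_setOf_mul_eq_smul (K := ℂ) L (P * T)).subset fun z hz => ?_
  by_contra hbad
  have hinj (l) (hl : l ∈ L) (hlX : l * (P * T) = z • l) : l = 0 :=
    by_contra fun hne => hbad ⟨l, hl, hne, hlX⟩
  obtain ⟨S, hSL, hS⟩ := exists_mul_sub_eq_of_not_eigenvalue hXL hinj hPL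
  set N := algebraMap ℂ M.toStarSubalgebra z - P * T with hN
  have hPN : P * N = P * (algebraMap ℂ M.toStarSubalgebra z - T) := by
    rw [hN, mul_sub, mul_sub, ← mul_assoc, h.proj_mul_proj]
  have hNP : N * P = P * N := by
    rw [hPN, hN, sub_mul, mul_sub, hPTP, Algebra.commutes]
  have hPSL : P * S ∈ L := L.smul_mem P hSL
  have hPSN : P * S * N = P := by rw [mul_assoc, hS, h.proj_mul_proj]
  -- the left inverse `P S` of `N` in the corner `P M P` is a right inverse by injectivity
  have hNPS : P * N * (P * S) = P := by
    rw [← sub_eq_zero]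
    refine hinj _ (L.sub_mem (L.smul_mem (P * N) hPSL) hPL) ?_
    have h0 : (P * N * (P * S) - P) * N = 0 := by
      rw [sub_mul, mul_assoc (P * N), hPSN, mul_assoc P N P, hNP, ← mul_assoc, h.proj_mul_proj,
        sub_self]
    rw [hN, mul_sub, sub_eq_zero, ← Algebra.commutes, ← Algebra.smul_def] at h0
    exact h0.symm
  refine hz ⟨P * S, h.mem_aBounded hA (hLP hPSL), ?_, ?_⟩
  · rw [← h.mul_proj, mul_assoc A P, ← hPN, mul_assoc A, hNPS]
  · rw [mul_assoc A, ← hLP hPSL, mul_assoc (P * S) P, ← hPN, ← mul_assoc (P * S) P N,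
      hLP hPSL, hPSN, h.mul_proj]

/-! ### Finite `A`-spectra force `A` into the socle -/

/-- A nonzero `z` outside the `A`-spectrum of `A` is outside the spectrum of `A`: if `S` is an
`A`-inverse of `z - A`, then `z⁻¹ (A S + 1)` is an inverse of `z - A`. -/
theorem finite_spectrum_of_finite_aSpectrum {A : M.toStarSubalgebra}
    (hfin : (aSpectrum A A).Finite) : (spectrum ℂ (A : H →L[ℂ] H)).Finite := by
  refine (hfin.insert 0).subset fun z hz => ?_
  by_contra hbad
  rw [Set.mem_insert_iff, not_or] at hbad
  obtain ⟨hz0, hbad⟩ := hbad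
  obtain ⟨S, -, h1, h2⟩ := not_not.1 hbad
  set N : M.toStarSubalgebra := algebraMap ℂ _ z - A with hN
  have hz1 : (z⁻¹ : ℂ) • (algebraMap ℂ M.toStarSubalgebra z) = 1 := by
    rw [Algebra.algebraMap_eq_smul_one, smul_smul, inv_mul_cancel₀ hz0, one_smul]
  have hcomm : N * A = A * N := by
    rw [hN, sub_mul, mul_sub, Algebra.commutes]
  have hr : N * (z⁻¹ • (A * S + 1)) = 1 := by
    rw [mul_smul_comm, mul_add, ← mul_assoc, hcomm, h1, mul_one, hN, add_sub_cancel, hz1]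
  have hl : (z⁻¹ • (A * S + 1)) * N = 1 := by
    rw [smul_mul_assoc, add_mul, h2, one_mul, hN, add_sub_cancel, hz1]
  exact (spectrum.mem_iff.1 hz) (isUnit_iff_exists_and_exists.2
    ⟨⟨_, congrArg Subtype.val hr⟩, ⟨_, congrArg Subtype.val hl⟩⟩)

/-- If `S` is an `A`-inverse of `z - T`, where `T` lies in the corner `P M P` and `z ≠ 0`, then
`P S P + z⁻¹ (1 - P)` is an inverse of `z - T`. -/
theorem IsSupportInverse.spectrum_subset {A B P T : M.toStarSubalgebra}
    (h : IsSupportInverse A B P) (hPT : P * T = T) (hTP : T * P = T) :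
    spectrum ℂ (T : H →L[ℂ] H) ⊆ insert 0 (aSpectrum A T) := by
  intro z hz
  by_contra hbad
  rw [Set.mem_insert_iff, not_or] at hbad
  obtain ⟨hz0, hbad⟩ := hbad
  obtain ⟨S, -, h1, h2⟩ := not_not.1 hbad
  set N : M.toStarSubalgebra := algebraMap ℂ _ z - T with hN
  have hz1 : (z⁻¹ : ℂ) • (algebraMap ℂ M.toStarSubalgebra z) = 1 := by
    rw [Algebra.algebraMap_eq_smul_one, smul_smul, inv_mul_cancel₀ hz0, one_smul]
  have hNP : N * P = P * N := by
    rw [hN, sub_mul, mul_sub, Algebra.commutes, hPT, hTP]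
  have hPN : P * N * S = P := by
    have := congrArg (B * ·) h1
    simpa only [← mul_assoc, h.inv_mul] using this
  have hPSN : P * S * N = P := by
    have := congrArg (B * ·) h2
    simpa only [← mul_assoc, h.inv_mul] using this
  have hT1 : T * (1 - P) = 0 := by rw [mul_sub, mul_one, hTP, sub_self]
  have hT2 : (1 - P) * T = 0 := by rw [sub_mul, one_mul, hPT, sub_self]
  have hr : N * (P * S * P + z⁻¹ • (1 - P)) = 1 := by
    have e : N * (1 - P) = algebraMap ℂ _ z * (1 - P) := by
      rw [hN, sub_mul, hT1, sub_zero]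
    rw [mul_add, mul_smul_comm, e, ← smul_mul_assoc, hz1, one_mul, ← mul_assoc, ← mul_assoc, hNP,
      hPN, h.proj_mul_proj, add_sub_cancel]
  have hl : (P * S * P + z⁻¹ • (1 - P)) * N = 1 := by
    have e : (1 - P) * N = algebraMap ℂ _ z * (1 - P) := by
      rw [hN, mul_sub, hT2, sub_zero, Algebra.commutes]
    rw [add_mul, smul_mul_assoc, e, ← smul_mul_assoc, hz1, one_mul, mul_assoc, ← hNP, ← mul_assoc,
      hPSN, h.proj_mul_proj, add_sub_cancel]
  exact (spectrum.mem_iff.1 hz) (isUnit_iff_exists_and_exists.2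
    ⟨⟨_, congrArg Subtype.val hr⟩, ⟨_, congrArg Subtype.val hl⟩⟩)

/-- A strictly decreasing sequence of projections `e₀ > e₁ > ⋯` yields the self-adjoint element
`∑ 2⁻ⁿ eₙ` which has infinite spectrum: on the range of `eₙ - eₙ₊₁` it acts as the scalar
`∑_{m ≤ n} 2⁻ᵐ`. -/
theorem exists_infinite_spectrum_of_descending {P : H →L[ℂ] H} {e : ℕ → H →L[ℂ] H}
    (heM : ∀ n, e n ∈ M) (he : ∀ n, IsStarProjection (e n)) (hP : ∀ n, P * e n = e n)
    (hle : ∀ n, e n * e (n + 1) = e (n + 1)) (hne : ∀ n, e (n + 1) ≠ e n) :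
    ∃ T ∈ M, IsSelfAdjoint T ∧ P * T = T ∧ (spectrum ℂ T).Infinite := by
  have hle' (n m : ℕ) (hnm : n ≤ m) : e n * e m = e m := by
    induction m, hnm using Nat.le_induction with
    | base => exact (he n).isIdempotentElem
    | succ m _ ih => rw [← hle m, ← mul_assoc, ih]
  have hge' (n m : ℕ) (hnm : n ≤ m) : e m * e n = e m := by
    have := congrArg star (hle' n m hnm)
    rwa [star_mul, (he n).isSelfAdjoint.star_eq, (he m).isSelfAdjoint.star_eq] at this
  have hsum : Summable fun n => ((1 / 2 : ℝ) ^ n) • e n := by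
    refine Summable.of_norm_bounded summable_geometric_two fun n => ?_
    rw [norm_smul, Real.norm_of_nonneg (by positivity)]
    exact mul_le_of_le_one_right (by positivity) (he n).norm_le
  set T : H →L[ℂ] H := ∑' n, ((1 / 2 : ℝ) ^ n) • e n with hT
  have hTd (n : ℕ) : T * (e n - e (n + 1)) =
      (∑ m ∈ Finset.range (n + 1), (1 / 2 : ℝ) ^ m) • (e n - e (n + 1)) := by
    rw [hT, ← hsum.tsum_mul_right, tsum_eq_sum (s := Finset.range (n + 1)), Finset.sum_smul]
    · refine Finset.sum_congr rfl fun m hm => ?_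
      have hmn : m ≤ n := Nat.lt_succ_iff.1 (Finset.mem_range.1 hm)
      rw [smul_mul_assoc, mul_sub, hle' m n hmn, hle' m (n + 1) (by lia)]
    · intro m hm
      have hmn : n + 1 ≤ m := not_lt.1 fun h => hm (Finset.mem_range.2 h)
      rw [smul_mul_assoc, mul_sub, hge' n m (by lia), hge' (n + 1) m hmn, sub_self, smul_zero]
  refine ⟨T, mem_of_commute_commutant fun y hy => ?_, ?_, ?_, ?_⟩
  · exact (Commute.tsum_right y fun n =>
      ((commute_of_mem_commutant (heM n) hy).symm.smul_right _)).symm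
  · rw [IsSelfAdjoint, hT, tsum_star]
    simp only [star_smul, (he _).isSelfAdjoint.star_eq, star_trivial]
  · rw [hT, ← hsum.tsum_mul_left]
    simp only [mul_smul_comm, hP]
  · refine Set.infinite_of_injective_forall_mem
      (f := fun n : ℕ => ((∑ m ∈ Finset.range (n + 1), (1 / 2 : ℝ) ^ m : ℝ) : ℂ)) ?_ fun n hn => ?_
    · refine Complex.ofReal_injective.comp (strictMono_nat_of_lt_succ fun n => ?_).injective
      rw [Finset.sum_range_succ _ (n + 1)]
      exact lt_add_of_pos_right _ (by positivity)
    · refine hne n (sub_eq_zero.1 ((hn.mul_right_eq_zero).1 ?_)).symm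
      rw [sub_mul, hTd, ← Algebra.smul_def, Complex.coe_smul, sub_self]

/-- If every self-adjoint element of the corner `P M P` has finite spectrum, then `P` is a finite
sum of minimal projections, each of which generates a minimal left ideal. -/
theorem mem_socle_of_forall_finite_spectrum {P : M.toStarSubalgebra} (hPstar : star P = P)
    (hPP : P * P = P)
    (hfin : ∀ T : M.toStarSubalgebra, IsSelfAdjoint T → P * T = T →
      (spectrum ℂ (T : H →L[ℂ] H)).Finite) : P ∈ socle M.toStarSubalgebra := by
  let r : {e : M.toStarSubalgebra // IsStarProjection e ∧ P * e = e} →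
      {e : M.toStarSubalgebra // IsStarProjection e ∧ P * e = e} → Prop :=
    fun e' e => (e : M.toStarSubalgebra) * e' = e' ∧ e' ≠ e
  have hwf : WellFounded r := by
    rw [wellFounded_iff_isEmpty_descending_chain]
    refine ⟨fun ⟨e, he⟩ => ?_⟩
    obtain ⟨T, hTM, hTsa, hPT, hT⟩ := exists_infinite_spectrum_of_descending (M := M)
      (P := (P : H →L[ℂ] H)) (e := fun n => ((e n : M.toStarSubalgebra) : H →L[ℂ] H))
      (fun n => (e n : M.toStarSubalgebra).2)
      (fun n => ⟨congrArg Subtype.val (e n).2.1.isIdempotentElem,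
        congrArg Subtype.val (e n).2.1.isSelfAdjoint⟩)
      (fun n => congrArg Subtype.val (e n).2.2)
      (fun n => congrArg Subtype.val (he n).1)
      (fun n h => (he n).2 (Subtype.ext (Subtype.ext h)))
    exact hT (hfin ⟨T, hTM⟩ (Subtype.ext hTsa) (Subtype.ext hPT))
  suffices H : ∀ e : {e : M.toStarSubalgebra // IsStarProjection e ∧ P * e = e},
      (e : M.toStarSubalgebra) ∈ socle M.toStarSubalgebra from H ⟨P, ⟨hPP, hPstar⟩, hPP⟩
  intro e
  induction e using hwf.induction with
  | _ e ih =>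
  obtain ⟨e, he, hPe⟩ := e
  by_cases hmin : ∃ e', IsStarProjection e' ∧ e * e' = e' ∧ e' ≠ 0 ∧ e' ≠ e
  · obtain ⟨e', he', hee', h0, hne⟩ := hmin
    have hPe' : P * e' = e' := by rw [← hee', ← mul_assoc, hPe]
    have he'e : e' * e = e' := by
      have := congrArg star hee'
      rwa [star_mul, he.isSelfAdjoint.star_eq, he'.isSelfAdjoint.star_eq] at this
    have hsub : IsStarProjection (e - e') := by
      refine ⟨?_, he.isSelfAdjoint.sub he'.isSelfAdjoint⟩
      rw [IsIdempotentElem, sub_mul, mul_sub, mul_sub, he.isIdempotentElem.eq,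
        he'.isIdempotentElem.eq, hee', he'e, sub_self, sub_zero]
    have h1 := ih ⟨e', he', hPe'⟩ ⟨hee', fun h => hne (congrArg Subtype.val h)⟩
    have h2 := ih ⟨e - e', hsub, by rw [mul_sub, hPe, hPe']⟩
      ⟨by rw [mul_sub, he.isIdempotentElem.eq, hee'],
        fun h => h0 (by simpa using congrArg Subtype.val h)⟩
    simpa using add_mem h1 h2
  · push Not at hmin
    refine mem_socle_of_forall_exists_mul_eq fun x hx => ?_
    have heT : e * (star (x * e) * (x * e)) = star (x * e) * (x * e) := by
        simp only [star_mul, he.isSelfAdjoint.star_eq, ← mul_assoc, he.isIdempotentElem.eq]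
    have hT0 : ((star (x * e) * (x * e) : M.toStarSubalgebra) : H →L[ℂ] H) ≠ 0 := fun h =>
      hx (Subtype.ext ((CStarRing.star_mul_self_eq_zero_iff ((x * e : M.toStarSubalgebra) :
        H →L[ℂ] H)).1 h))
    have hTsa := IsSelfAdjoint.star_mul_self (x * e)
    set T : M.toStarSubalgebra := star (x * e) * (x * e) with hT
    -- a nonzero spectral projection of `T` lies under the minimal `e`, so `T` is a multiple of `e`
    obtain ⟨c, hc, Q, hQ, G, hG, hQproj, hQ0, hTG, hTQ⟩ := exists_eigenprojection T.2
      (congrArg Subtype.val hTsa) (hfin T hTsa (by rw [← heT, ← mul_assoc, hPe])) hT0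
    have hQe : (⟨Q, hQ⟩ : M.toStarSubalgebra) = e := by
      refine hmin _ ⟨Subtype.ext hQproj.isIdempotentElem, Subtype.ext hQproj.isSelfAdjoint⟩ ?_
        fun h => hQ0 (congrArg Subtype.val h)
      have : T * ⟨G, hG⟩ = ⟨Q, hQ⟩ := Subtype.ext hTG
      rw [← this, ← mul_assoc, heT]
    refine ⟨(c : ℂ)⁻¹ • star (x * e), ?_⟩
    have hTe : T = (c : ℂ) • e := by
      have h1 : T * e = (c : ℂ) • e := by
        rw [← hQe]
        exact Subtype.ext hTQ
      rw [← h1, hT, mul_assoc, mul_assoc x, he.isIdempotentElem.eq]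
    rw [smul_mul_assoc, ← hT, hTe, smul_smul, inv_mul_cancel₀ (by exact_mod_cast hc), one_smul]

theorem mem_socle_of_forall_finite_aSpectrum {A : M.toStarSubalgebra}
    (hA : (A : H →L[ℂ] H).IsPositive) (hfin : ∀ T ∈ aBounded A, (aSpectrum A T).Finite) :
    A ∈ socle M.toStarSubalgebra := by
  obtain ⟨B, P, h⟩ := exists_isSupportInverse hA.isSelfAdjoint
    (finite_spectrum_of_finite_aSpectrum (hfin A (self_mem_aBounded hA)))
  have hP : P ∈ socle M.toStarSubalgebra := by
    refine mem_socle_of_forall_finite_spectrum h.star_proj h.proj_mul_proj fun T hT hPT => ?_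
    have hTP : T * P = T := by
      have := congrArg star hPT
      rwa [star_mul, hT.star_eq, h.star_proj] at this
    exact ((hfin T (h.mem_aBounded hA hTP)).insert 0).subset (h.spectrum_subset hPT hTP)
  rw [← h.mul_proj]
  exact (socle M.toStarSubalgebra).smul_mem A hP

end VonNeumann

end ASpec

/-- For a positive element `A` of a von Neumann algebra `M`, the `A`-spectrum of every `T` in `M^A`
is finite if and only if `A` lies in the socle of `M`. -/
theorem theorem3p1 {H : Type*} [NormedAddCommGroup H] [InnerProductSpace ℂ H] [CompleteSpace H]
    (M : VonNeumannAlgebra H) (A : M.toStarSubalgebra)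
    (hA : (A : H →L[ℂ] H).IsPositive) :
    (∀ T ∈ ASpec.aBounded A, (ASpec.aSpectrum A T).Finite) ↔
      A ∈ ASpec.socle M.toStarSubalgebra := by
  exact ⟨ASpec.mem_socle_of_forall_finite_aSpectrum hA,
    fun hsoc _ hT => ASpec.finite_aSpectrum_of_mem_socle hA hsoc hT⟩
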